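/- Let $A\subset C$ and $B\subset D$ be unital inclusions of unital $C^*$-algebras which are strongly Morita equivalent with respect to a $C$-$D$-equivalence bimodule $Y$ and its closed subspace $X$; that is, $a\cdot x,\ x\cdot b\in X$, ${}_C\langle x,z\rangle\in A$ and $\langle x,z\rangle_D\in B$ for all $a\in A$, $b\in B$, $x,z\in X$, and $\overline{\operatorname{span}}\,{}_C\langle X,X\rangle=A$, $\overline{\operatorname{span}}\,\langle X,X\rangle_D=B$, $\overline{\operatorname{span}}\,{}_C\langle Y,X\rangle=C$, $\overline{\operatorname{span}}\,\langle Y,X\rangle_D=D$. Let ${}_A\mathbf B_A(C,A)$ and ${}_B\mathbf B_B(D,B)$ be the spaces of bounded $A$-bimodule linear maps $C\to A$ and of bounded $B$-bimodule linear maps $D\to B$. For $\phi\in{}_A\mathbf B_A(C,A)$ let $f(\phi)\in{}_B\mathbf B_B(D,B)$ be the second member $\psi$ of the unique pair consisting of a linear map $\tau:Y\to X$ and a $\psi\in{}_B\mathbf B_B(D,B)$ such that, for all $a\in A$, $b\in B$, $c\in C$, $d\in D$, $x\in X$, $y\in Y$, $$\tau(c\cdot x)=\phi(c)\cdot x,\quad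 \tau(a\cdot y)=a\cdot\tau(y),\quad {}_C\langle\tau(y),x\rangle=\phi({}_C\langle y,x\rangle),$$ $$\tau(x\cdot d)=x\cdot\psi(d),\quad \tau(y\cdot b)=\tau(y)\cdot b,\quad \psi(\langle x,y\rangle_D)=\langle x,\tau(y)\rangle_D .$$ Let $\phi$ be a conditional expectation from $C$ onto $A$ (a positive element of ${}_A\mathbf B_A(C,A)$ with $\phi(a)=a$ for all $a\in A$), and suppose that there is a number $t>0$ with $\phi(c)\ge tc$ for every positive $c\in C$. Then there is a number $s>0$ such that $f(\phi)(d)\ge sd$ for every positive $d\in D$. -/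

import Mathlib

open MulOpposite

namespace CStarInclusion

/-- The left `C`-valued inner product `_C⟨x, y⟩`, which is linear in the first variable and
satisfies `_C⟨c·x, y⟩ = c _C⟨x, y⟩`. (Mathlib's `inner C` is linear in its second variable and
satisfies `inner C x (c • y) = c * inner C x y`, so the two arguments are swapped.) -/
def leftInner (C : Type*) {Y : Type*} [CStarAlgebra C] [PartialOrder C]
    [NormedAddCommGroup Y] [NormedSpace ℂ Y] [Module C Y] [CStarModule C Y] (x y : Y) : C :=
  inner C y x

/-- The right `D`-valued inner product `⟨x, y⟩_D`, which is linear in the second variable and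
satisfies `⟨x, y·d⟩_D = ⟨x, y⟩_D d`. Here the right action `y·d` is `op d • y`. -/
def rightInner (D : Type*) {Y : Type*} [CStarAlgebra D] [PartialOrder D]
    [NormedAddCommGroup Y] [NormedSpace ℂ Y] [Module Dᵐᵒᵖ Y] [CStarModule Dᵐᵒᵖ Y] (x y : Y) : D :=
  unop (inner Dᵐᵒᵖ x y)

/-- `Y` is a `C`-`D`-equivalence (imprimitivity) bimodule. The Hilbert module structures on
both sides are the two `CStarModule` instances (they induce the same norm, for which `Y` is
complete); the remaining requirements are that both are full, that each algebra acts by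
adjointable operators for the other inner product, and `_C⟨x, y⟩·z = x·⟨y, z⟩_D`. -/
class IsEquivalenceBimodule (C D Y : Type*) [CStarAlgebra C] [PartialOrder C]
    [CStarAlgebra D] [PartialOrder D] [NormedAddCommGroup Y] [NormedSpace ℂ Y]
    [Module C Y] [Module Dᵐᵒᵖ Y] [CStarModule C Y] [CStarModule Dᵐᵒᵖ Y] : Prop where
  complete : CompleteSpace Y
  leftInner_smul (x y z : Y) : leftInner C x y • z = op (rightInner D y z) • x
  rightInner_smul_left (c : C) (x y : Y) :
    rightInner D (c • x) y = rightInner D x (star c • y)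
  leftInner_op_smul_left (d : D) (x y : Y) :
    leftInner C (op d • x) y = leftInner C x (op (star d) • y)
  left_full : closure
    (Submodule.span ℂ {c : C | ∃ x y : Y, leftInner C x y = c} : Set C) = Set.univ
  right_full : closure
    (Submodule.span ℂ {d : D | ∃ x y : Y, rightInner D x y = d} : Set D) = Set.univ

section Equivalence

variable {C D Y : Type*} [CStarAlgebra C] [PartialOrder C] [CStarAlgebra D] [PartialOrder D]
  [NormedAddCommGroup Y] [NormedSpace ℂ Y] [Module C Y] [Module Dᵐᵒᵖ Y]
  [CStarModule C Y] [CStarModule Dᵐᵒᵖ Y]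

/-- The unital inclusions of unital C⋆-algebras `A ⊆ C` and `B ⊆ D` are strongly Morita
equivalent with respect to the `C`-`D`-equivalence bimodule `Y` and its closed subspace `X`. -/
structure IsMoritaEquivalence (A : StarSubalgebra ℂ C) (B : StarSubalgebra ℂ D)
    (X : Submodule ℂ Y) : Prop where
  bimodule : IsEquivalenceBimodule C D Y
  isClosed_left : IsClosed (A : Set C)
  isClosed_right : IsClosed (B : Set D)
  isClosed_sub : IsClosed (X : Set Y)
  smul_mem : ∀ a ∈ A, ∀ x ∈ X, a • x ∈ X
  op_smul_mem : ∀ b ∈ B, ∀ x ∈ X, op b • x ∈ X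
  leftInner_mem : ∀ x ∈ X, ∀ z ∈ X, leftInner C x z ∈ A
  rightInner_mem : ∀ x ∈ X, ∀ z ∈ X, rightInner D x z ∈ B
  left_full : closure
    (Submodule.span ℂ {c : C | ∃ x ∈ X, ∃ z ∈ X, leftInner C x z = c} : Set C) = A
  right_full : closure
    (Submodule.span ℂ {d : D | ∃ x ∈ X, ∃ z ∈ X, rightInner D x z = d} : Set D) = B
  left_full_mixed : closure
    (Submodule.span ℂ {c : C | ∃ y : Y, ∃ x ∈ X, leftInner C y x = c} : Set C) = Set.univ
  right_full_mixed : closure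
    (Submodule.span ℂ {d : D | ∃ y : Y, ∃ x ∈ X, rightInner D y x = d} : Set D) = Set.univ

end Equivalence

/-- The space of bounded `A`-bimodule linear maps from `C` to `A`. -/
def bimoduleMaps {C : Type*} [CStarAlgebra C] (A : StarSubalgebra ℂ C) :
    Submodule ℂ (C →L[ℂ] A) where
  carrier := {φ | ∀ (a : A) (c : C), φ (a * c) = a * φ c ∧ φ (c * a) = φ c * a}
  add_mem' := fun {φ ψ} hφ hψ a c => by
    simp [(hφ a c).1, (hφ a c).2, (hψ a c).1, (hψ a c).2, mul_add, add_mul]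
  zero_mem' := fun a c => by simp
  smul_mem' := fun k φ hφ a c => by simp [(hφ a c).1, (hφ a c).2]

/-- A conditional expectation from `C` onto `A`: a bounded `A`-bimodule linear map `C → A` that is
positive and restricts to the identity on `A`. -/
structure IsConditionalExpectation {C : Type*} [CStarAlgebra C] [PartialOrder C]
    {A : StarSubalgebra ℂ C} (φ : bimoduleMaps A) : Prop where
  nonneg : ∀ c : C, 0 ≤ c → 0 ≤ (φ.1 c : C)
  apply_coe : ∀ a : A, φ.1 (a : C) = a

section Continuity

variable {C Y : Type*} [CStarAlgebra C] [PartialOrder C]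
  [NormedAddCommGroup Y] [NormedSpace ℂ Y] [Module C Y] [CStarModule C Y]

theorem continuous_smul_const [IsScalarTower ℂ C Y] (y : Y) : Continuous fun c : C => c • y := by
  let L : C →ₗ[ℂ] Y :=
    { toFun := fun c => c • y
      map_add' := fun a b => add_smul a b y
      map_smul' := fun k a => smul_assoc k a y }
  refine (L.mkContinuous ‖y‖ fun c => ?_).continuous
  refine le_of_sq_le_sq ?_ (by positivity)
  change ‖c • y‖ ^ 2 ≤ _
  rw [CStarModule.norm_sq_eq C, mul_pow, CStarModule.norm_sq_eq C,
    CStarModule.inner_op_smul_right, CStarModule.inner_op_smul_left]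
  calc ‖c * (inner C y y * star c)‖ ≤ ‖c‖ * (‖inner C y y‖ * ‖star c‖) :=
        (norm_mul_le _ _).trans (by gcongr; exact norm_mul_le _ _)
    _ = ‖inner C y y‖ * ‖c‖ ^ 2 := by rw [norm_star]; ring

variable [StarOrderedRing C]

theorem continuous_inner_right (x : Y) : Continuous fun y : Y => inner C x y :=
  (CStarModule.innerSL (A := C) x).continuous

theorem continuous_inner_left (x : Y) : Continuous fun y : Y => inner C y x := by
  have : (fun y : Y => inner C y x) = fun y => star (inner C x y) := by
    funext y; simp
  rw [this]
  exact (continuous_inner_right x).star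

end Continuity

section Transfer

variable {C D Y : Type*} [CStarAlgebra C] [PartialOrder C] [CStarAlgebra D] [PartialOrder D]
  [NormedAddCommGroup Y] [NormedSpace ℂ Y] [Module C Y] [Module Dᵐᵒᵖ Y]
  [CStarModule C Y] [CStarModule Dᵐᵒᵖ Y]

/-- The linear map `τ : Y → X` and the map `ψ : D → B` are the ones associated with the bounded
`A`-bimodule map `φ : C → A`. -/
structure IsTransfer {A : StarSubalgebra ℂ C} {B : StarSubalgebra ℂ D} {X : Submodule ℂ Y}
    (φ : bimoduleMaps A) (τ : Y →ₗ[ℂ] X) (ψ : bimoduleMaps B) : Prop where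
  map_smul_coe (c : C) (x : X) : (τ (c • (x : Y)) : Y) = (φ.1 c : C) • (x : Y)
  map_coe_smul (a : A) (y : Y) : (τ ((a : C) • y) : Y) = (a : C) • (τ y : Y)
  leftInner_map (y : Y) (x : X) : leftInner C (τ y : Y) (x : Y) = φ.1 (leftInner C y (x : Y))
  map_op_smul_coe (x : X) (d : D) : (τ (op d • (x : Y)) : Y) = op (ψ.1 d : D) • (x : Y)
  map_op_coe_smul (b : B) (y : Y) : (τ (op (b : D) • y) : Y) = op (b : D) • (τ y : Y)
  map_rightInner (x : X) (y : Y) :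
    (ψ.1 (rightInner D (x : Y) y) : D) = rightInner D (x : Y) (τ y : Y)

/-- A finite frame: `∑ ⟨u i, v i⟩_D = 1` with `u i, v i ∈ X`. -/
theorem IsMoritaEquivalence.exists_frame {A : StarSubalgebra ℂ C} {B : StarSubalgebra ℂ D}
    {X : Submodule ℂ Y} (h : IsMoritaEquivalence A B X) :
    ∃ (n : Type) (_ : Fintype n) (u v : n → X), ∑ i, rightInner D (u i : Y) (v i : Y) = 1 := by
  have key : ∀ b ∈ Submodule.span ℂ {d : D | ∃ x ∈ X, ∃ z ∈ X, rightInner D x z = d},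
      ∃ (n : Type) (_ : Fintype n) (u v : n → X),
        ∑ i, rightInner D (u i : Y) (v i : Y) = b := by
    intro b hb
    induction hb using Submodule.span_induction with
    | mem b hb =>
      obtain ⟨x, hx, z, hz, rfl⟩ := hb
      exact ⟨Unit, inferInstance, fun _ => ⟨x, hx⟩, fun _ => ⟨z, hz⟩, by simp⟩
    | zero => exact ⟨Empty, inferInstance, fun i => i.elim, fun i => i.elim, by simp⟩
    | add a b _ _ ha hb =>
      obtain ⟨n, _, u, v, rfl⟩ := ha
      obtain ⟨m, _, u', v', rfl⟩ := hb
      exact ⟨n ⊕ m, inferInstance, Sum.elim u u', Sum.elim v v', by simp⟩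
    | smul k b _ hb =>
      obtain ⟨n, _, u, v, rfl⟩ := hb
      exact ⟨n, inferInstance, u, fun i => k • v i, by simp [rightInner, Finset.smul_sum]⟩
  have h1 : (1 : D) ∈ closure
      (Submodule.span ℂ {d : D | ∃ x ∈ X, ∃ z ∈ X, rightInner D x z = d} : Set D) := by
    rw [h.right_full]; exact one_mem B
  obtain ⟨b, hb, hb1⟩ := Metric.mem_closure_iff.1 h1 1 one_pos
  have hbB : b ∈ B := by
    have := subset_closure hb
    rwa [h.right_full] at this
  have := h.isClosed_right
  have : CompleteSpace B := h.isClosed_right.completeSpace_coe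
  let u := Units.oneSub (1 - (⟨b, hbB⟩ : B)) (by
    rw [dist_eq_norm] at hb1; simpa using hb1)
  have hu : b * ((u⁻¹ : Bˣ) : B) = 1 := by
    have : (u : B) = ⟨b, hbB⟩ := by simp [u]
    have h2 := u.mul_inv
    rw [this] at h2
    exact congrArg Subtype.val h2
  obtain ⟨n, _, p, q, rfl⟩ := key b hb
  refine ⟨n, inferInstance, p,
    fun i => ⟨op ((u⁻¹ : Bˣ) : D) • (q i : Y), h.op_smul_mem _ (Subtype.coe_prop _) _ (q i).2⟩, ?_⟩
  rw [← hu, Finset.sum_mul]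
  simp [rightInner]

variable [StarOrderedRing C] [StarOrderedRing D]
  [IsScalarTower ℂ C Y] [IsScalarTower ℂ Dᵐᵒᵖ Y] [SMulCommClass C Dᵐᵒᵖ Y]

/-- For every bounded `A`-bimodule map `φ : C → A` there is exactly one pair `(τ, ψ)` associated
with it. -/
theorem IsMoritaEquivalence.existsUnique_transfer
    {A : StarSubalgebra ℂ C} {B : StarSubalgebra ℂ D}
    {X : Submodule ℂ Y} (h : IsMoritaEquivalence A B X) (φ : bimoduleMaps A) :
    ∃! p : (Y →ₗ[ℂ] X) × bimoduleMaps B, IsTransfer φ p.1 p.2 := by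
  obtain ⟨n, _, u, v, huv⟩ := h.exists_frame
  have hY := h.bimodule
  have hcomm := SMulCommClass.symm C Dᵐᵒᵖ Y
  have hcompat := hY.leftInner_smul
  have l_add (x y z : Y) : leftInner C (x + y) z = leftInner C x z + leftInner C y z := by
    simp [leftInner]
  have l_smulc (k : ℂ) (x z : Y) : leftInner C (k • x) z = k • leftInner C x z := by
    simp [leftInner]
  have l_smul (c : C) (x z : Y) : leftInner C (c • x) z = c * leftInner C x z := by
    simp [leftInner]
  have l_sum (w : n → Y) (z : Y) : leftInner C (∑ i, w i) z = ∑ i, leftInner C (w i) z := by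
    simp [leftInner]
  have φ_left (a : C) (ha : a ∈ A) (c : C) : (φ.1 (a * c) : C) = a * φ.1 c :=
    congrArg Subtype.val (φ.2 ⟨a, ha⟩ c).1
  have φ_right (a : C) (ha : a ∈ A) (c : C) : (φ.1 (c * a) : C) = φ.1 c * a :=
    congrArg Subtype.val (φ.2 ⟨a, ha⟩ c).2
  have expand (y : Y) : ∑ i, leftInner C y (u i : Y) • (v i : Y) = y := by
    simp_rw [hcompat]
    have : ∑ i, op (rightInner D (u i : Y) (v i : Y)) = (1 : Dᵐᵒᵖ) := by
      rw [← op_one, ← huv]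
      exact (map_sum (opAddEquiv : D ≃+ Dᵐᵒᵖ) _ _).symm
    rw [← Finset.sum_smul, this, one_smul]
  -- the map `τ`
  let τ : Y →ₗ[ℂ] X :=
    { toFun := fun y => ∑ i, ⟨(φ.1 (leftInner C y (u i : Y)) : C) • (v i : Y),
        h.smul_mem _ (Subtype.coe_prop _) _ (v i).2⟩
      map_add' := fun x y => by
        ext; simp [l_add, add_smul, Finset.sum_add_distrib]
      map_smul' := fun k x => by
        ext; simp [l_smulc, Finset.smul_sum] }
  have τ_apply (y : Y) : (τ y : Y) = ∑ i, (φ.1 (leftInner C y (u i : Y)) : C) • (v i : Y) := by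
    simp [τ]
  have τ1 (c : C) (x : X) : (τ (c • (x : Y)) : Y) = (φ.1 c : C) • (x : Y) := by
    conv_rhs => rw [← expand (x : Y)]
    rw [τ_apply, Finset.smul_sum]
    refine Finset.sum_congr rfl fun i _ => ?_
    rw [l_smul, φ_right _ (h.leftInner_mem _ x.2 _ (u i).2), mul_smul]
  have τ2 (a : C) (ha : a ∈ A) (y : Y) : (τ (a • y) : Y) = a • (τ y : Y) := by
    rw [τ_apply, τ_apply, Finset.smul_sum]
    refine Finset.sum_congr rfl fun i _ => ?_
    rw [l_smul, φ_left _ ha, mul_smul]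
  have τ3 (y : Y) (x : X) :
      leftInner C (τ y : Y) (x : Y) = φ.1 (leftInner C y (x : Y)) := by
    conv_rhs => rw [← expand y]
    rw [τ_apply, l_sum, l_sum, map_sum, AddSubmonoidClass.coe_finsetSum]
    refine Finset.sum_congr rfl fun i _ => ?_
    rw [l_smul, l_smul, φ_right _ (h.leftInner_mem _ (v i).2 _ x.2)]
  have τ_cont : Continuous fun y => (τ y : Y) := by
    simp_rw [τ_apply]
    refine continuous_finsetSum _ fun i _ => ?_
    exact (continuous_smul_const (v i : Y)).comp (continuous_subtype_val.comp
      (φ.1.continuous.comp (continuous_inner_right (u i : Y))))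
  have r_add (x y z : Y) : rightInner D x (y + z) = rightInner D x y + rightInner D x z := by
    simp [rightInner]
  have r_smulc (k : ℂ) (x z : Y) : rightInner D x (k • z) = k • rightInner D x z := by
    simp [rightInner]
  have r_smul (d : D) (x z : Y) : rightInner D x (op d • z) = rightInner D x z * d := by
    simp [rightInner]
  have op_sum (w : n → D) (y : Y) : op (∑ i, w i) • y = ∑ i, op (w i) • y := by
    rw [← Finset.sum_smul]
    exact congrArg (· • y) (map_sum (opAddEquiv : D ≃+ Dᵐᵒᵖ) _ _)
  have op_mul_smul (d e : D) (y : Y) : op (d * e) • y = op e • (op d • y) := by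
    rw [op_mul, mul_smul]
  -- elements of `D` are determined by their right action on `X`
  have faithful (d e : D) (hde : ∀ x : X, op d • (x : Y) = op e • (x : Y)) : d = e := by
    have key (d : D) : d = ∑ i, rightInner D (u i : Y) (op d • (v i : Y)) := by
      simp_rw [r_smul, ← Finset.sum_mul, huv, one_mul]
    rw [key d, key e]
    simp_rw [hde]
  -- the map `ψ`
  let ψ₀ : D →ₗ[ℂ] B :=
    { toFun := fun d => ∑ i, ⟨rightInner D (u i : Y) (τ (op d • (v i : Y)) : Y),
        h.rightInner_mem _ (u i).2 _ (Subtype.coe_prop _)⟩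
      map_add' := fun d e => by
        ext; simp [r_add, add_smul, Finset.sum_add_distrib]
      map_smul' := fun k d => by
        ext; simp [r_smulc, Finset.smul_sum] }
  have ψ_apply (d : D) :
      (ψ₀ d : D) = ∑ i, rightInner D (u i : Y) (τ (op d • (v i : Y)) : Y) := by
    simp [ψ₀]
  have ψ_cont : Continuous ψ₀ := by
    refine continuous_induced_rng.2 ?_
    change Continuous fun d => (ψ₀ d : D)
    simp_rw [ψ_apply]
    refine continuous_finsetSum _ fun i _ => ?_
    exact continuous_unop.comp ((continuous_inner_right (u i : Y)).comp
      (τ_cont.comp ((continuous_smul_const (v i : Y)).comp continuous_op)))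
  have τ4 (x : X) (d : D) : (τ (op d • (x : Y)) : Y) = op (ψ₀ d : D) • (x : Y) := by
    rw [ψ_apply, op_sum]
    simp_rw [← hcompat]
    conv_lhs => rw [← expand (x : Y), Finset.smul_sum, map_sum, AddSubmonoidClass.coe_finsetSum]
    refine Finset.sum_congr rfl fun i _ => ?_
    rw [smul_comm, τ2 _ (h.leftInner_mem _ x.2 _ (u i).2)]
  have τ6 (x : X) (y : Y) :
      (ψ₀ (rightInner D (x : Y) y) : D) = rightInner D (x : Y) (τ y : Y) := by
    refine faithful _ _ fun z => ?_
    rw [← τ4, ← hcompat, τ2 _ (h.leftInner_mem _ z.2 _ x.2), hcompat]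
  have τ5 (b : D) (hb : b ∈ B) (y : Y) : (τ (op b • y) : Y) = op b • (τ y : Y) := by
    have e := expand y
    rw [← e, Finset.smul_sum, map_sum, map_sum, AddSubmonoidClass.coe_finsetSum,
      AddSubmonoidClass.coe_finsetSum, Finset.smul_sum]
    refine Finset.sum_congr rfl fun i _ => ?_
    have := τ1 (leftInner C y (u i : Y)) ⟨op b • (v i : Y), h.op_smul_mem _ hb _ (v i).2⟩
    rw [smul_comm, this, τ1, smul_comm]
  have ψ_mem : (⟨ψ₀, ψ_cont⟩ : D →L[ℂ] B) ∈ bimoduleMaps B := by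
    intro b d
    constructor
    · refine Subtype.ext (faithful _ _ fun x => ?_)
      have := τ4 ⟨op (b : D) • (x : Y), h.op_smul_mem _ b.2 _ x.2⟩ d
      change op (ψ₀ (b * d) : D) • (x : Y) = op ((b : D) * (ψ₀ d : D)) • (x : Y)
      rw [← τ4, op_mul_smul, op_mul_smul, this]
    · refine Subtype.ext (faithful _ _ fun x => ?_)
      change op (ψ₀ (d * b) : D) • (x : Y) = op ((ψ₀ d : D) * (b : D)) • (x : Y)
      rw [← τ4, op_mul_smul, op_mul_smul, τ5 _ b.2, τ4]
  refine ⟨(τ, ⟨⟨ψ₀, ψ_cont⟩, ψ_mem⟩),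
    ⟨τ1, fun a y => τ2 a a.2 y, τ3, τ4, fun b y => τ5 b b.2 y, τ6⟩, ?_⟩
  rintro ⟨τ', ψ'⟩ h'
  have hτ : τ' = τ := by
    ext y
    rw [← sub_eq_zero, ← CStarModule.inner_self (A := C)]
    have e : leftInner C (τ' y : Y) ((τ' y - τ y : X) : Y)
        = leftInner C (τ y : Y) ((τ' y - τ y : X) : Y) := by
      rw [τ3, h'.leftInner_map]
    rw [← AddSubgroupClass.coe_sub]
    simp only [leftInner] at e
    conv_lhs => rw [AddSubgroupClass.coe_sub, CStarModule.inner_sub_right,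
      ← AddSubgroupClass.coe_sub]
    rw [e, sub_self]
  refine Prod.ext hτ (Subtype.ext (ContinuousLinearMap.ext fun d =>
    Subtype.ext (faithful _ _ fun x => ?_)))
  change op (ψ'.1 d : D) • (x : Y) = op (ψ₀ d : D) • (x : Y)
  rw [← τ4, ← h'.map_op_smul_coe, hτ]

/-- The map `f` from bounded `A`-bimodule maps `C → A` to bounded `B`-bimodule maps `D → B`
induced by `(X, Y)`: `f φ` is the `ψ` of the unique pair `(τ, ψ)` associated with `φ`. -/
noncomputable def IsMoritaEquivalence.transfer
    {A : StarSubalgebra ℂ C} {B : StarSubalgebra ℂ D}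
    {X : Submodule ℂ Y} (h : IsMoritaEquivalence A B X) (φ : bimoduleMaps A) : bimoduleMaps B :=
  (h.existsUnique_transfer φ).choose.2

end Transfer

end CStarInclusion

/-!
For `x ∈ X` the transferred map `ψ` satisfies
`_C⟨x·ψ(d), x⟩ = φ(_C⟨x·d, x⟩) ≥ t _C⟨x·d, x⟩`, so the task is to turn an inequality between the
forms `x ↦ _C⟨x·d, x⟩` on `X` into an order relation in `D`. A general `d : D` does not map `X`
into itself, so these forms need not detect its order; but a finite frame in `X` shows that the
norms `‖x·d‖`, `x ∈ X`, control `‖d‖` up to a constant `K`. If the form of `b ∈ B` dominates `K²`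
times the form of `d ≥ 0`, substituting `x·(b + ε)^(-1/2) ∈ X` for `x` yields
`‖√d (b + ε)^(-1/2)‖ ≤ 1`, that is, `d ≤ b + ε`.
-/

namespace CStarInclusion

section CStarAlgebra

variable {D : Type*} [CStarAlgebra D] [PartialOrder D] [StarOrderedRing D]

theorem le_of_forall_le_add_algebraMap {a b : D}
    (h : ∀ ε : ℝ, 0 < ε → a ≤ b + algebraMap ℝ D ε) : a ≤ b := by
  have hlim : Filter.Tendsto (fun ε : ℝ => b + algebraMap ℝ D ε)
      (nhdsWithin 0 (Set.Ioi 0)) (nhds b) := by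
    have hcont : Continuous fun ε : ℝ => b + algebraMap ℝ D ε := by fun_prop
    simpa using (hcont.tendsto 0).mono_left nhdsWithin_le_nhds
  exact ge_of_tendsto hlim (Filter.eventually_of_mem self_mem_nhdsWithin h)

theorem rpow_mem_of_isClosed {B : StarSubalgebra ℂ D} (hB : IsClosed (B : Set D)) {b : D}
    (hb : b ∈ B) (hb0 : 0 ≤ b) (r : ℝ) : b ^ r ∈ B := by
  rw [CFC.rpow_eq_cfc_real hb0]
  exact cfc_mem (𝕜' := ℂ) (hs := hB) _ hb

end CStarAlgebra

section LeftInner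

variable {C Y : Type*} [CStarAlgebra C] [PartialOrder C]
  [NormedAddCommGroup Y] [NormedSpace ℂ Y] [Module C Y] [CStarModule C Y]

theorem star_leftInner (x y : Y) : star (leftInner C x y) = leftInner C y x :=
  CStarModule.star_inner y x

theorem leftInner_self_nonneg (x : Y) : 0 ≤ leftInner C x x :=
  CStarModule.inner_self_nonneg

variable {D : Type*} [CStarAlgebra D] [Module Dᵐᵒᵖ Y]

theorem leftInner_op_sub_smul (d e : D) (x y : Y) :
    leftInner C (op (d - e) • x) y = leftInner C (op d • x) y - leftInner C (op e • x) y := by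
  simp [leftInner, sub_smul]

theorem leftInner_op_neg_smul (d : D) (x y : Y) :
    leftInner C (op (-d) • x) y = -leftInner C (op d • x) y := by
  simp [leftInner]

theorem leftInner_op_smul_smul [IsScalarTower ℂ Dᵐᵒᵖ Y] (k : ℂ) (d : D) (x y : Y) :
    leftInner C (op (k • d) • x) y = k • leftInner C (op d • x) y := by
  simp [leftInner]

end LeftInner

section EquivalenceBimodule

variable {C D Y : Type*} [CStarAlgebra C] [PartialOrder C] [CStarAlgebra D] [PartialOrder D]
  [NormedAddCommGroup Y] [NormedSpace ℂ Y] [Module C Y] [Module Dᵐᵒᵖ Y]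
  [CStarModule C Y] [CStarModule Dᵐᵒᵖ Y] [IsEquivalenceBimodule C D Y]

theorem leftInner_op_star_smul (d : D) (x : Y) :
    leftInner C (op (star d) • x) x = star (leftInner C (op d • x) x) := by
  rw [IsEquivalenceBimodule.leftInner_op_smul_left, star_star, star_leftInner]

theorem leftInner_op_conjugate_smul {k : D} (hk : IsSelfAdjoint k) (d : D) (x : Y) :
    leftInner C (op (k * d * k) • x) x = leftInner C (op d • op k • x) (op k • x) := by
  rw [op_mul, op_mul, mul_smul, mul_smul, IsEquivalenceBimodule.leftInner_op_smul_left,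
    hk.star_eq]

variable [StarOrderedRing D]

theorem leftInner_op_smul_eq_sqrt {d : D} (hd : 0 ≤ d) (x : Y) :
    leftInner C (op d • x) x = leftInner C (op (CFC.sqrt d) • x) (op (CFC.sqrt d) • x) := by
  have hsqrt : IsSelfAdjoint (CFC.sqrt d) := (CFC.sqrt_nonneg d).isSelfAdjoint
  conv_lhs => rw [← CFC.sqrt_mul_sqrt_self d hd, op_mul, mul_smul,
    IsEquivalenceBimodule.leftInner_op_smul_left, hsqrt.star_eq]

theorem leftInner_op_smul_self_nonneg {d : D} (hd : 0 ≤ d) (x : Y) :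
    0 ≤ leftInner C (op d • x) x := by
  rw [leftInner_op_smul_eq_sqrt hd]
  exact leftInner_self_nonneg _

theorem norm_op_sqrt_smul_sq {d : D} (hd : 0 ≤ d) (x : Y) :
    ‖op (CFC.sqrt d) • x‖ ^ 2 = ‖leftInner C (op d • x) x‖ := by
  rw [leftInner_op_smul_eq_sqrt hd]
  exact CStarModule.norm_sq_eq C

end EquivalenceBimodule

section MoritaEquivalence

variable {C D Y : Type*} [CStarAlgebra C] [PartialOrder C] [CStarAlgebra D] [PartialOrder D]
  [NormedAddCommGroup Y] [NormedSpace ℂ Y] [Module C Y] [Module Dᵐᵒᵖ Y]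
  [CStarModule C Y] [CStarModule Dᵐᵒᵖ Y]
  {A : StarSubalgebra ℂ C} {B : StarSubalgebra ℂ D} {X : Submodule ℂ Y}

theorem IsMoritaEquivalence.exists_norm_le [StarOrderedRing D] (h : IsMoritaEquivalence A B X) :
    ∃ K : ℝ, 0 < K ∧ ∀ (d : D) (M : ℝ), 0 ≤ M → (∀ x ∈ X, ‖op d • x‖ ≤ M * ‖x‖) →
      ‖d‖ ≤ K * M := by
  obtain ⟨n, _, u, v, huv⟩ := h.exists_frame
  refine ⟨∑ i, ‖(u i : Y)‖ * ‖(v i : Y)‖ + 1, by positivity, fun d M hM hd => ?_⟩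
  have hexpand : d = ∑ i, rightInner D (u i : Y) (op d • (v i : Y)) := by
    have hsmul (i : n) : rightInner D (u i : Y) (op d • (v i : Y)) =
        rightInner D (u i : Y) (v i : Y) * d := by simp [rightInner]
    simp_rw [hsmul, ← Finset.sum_mul, huv, one_mul]
  have hterm (i : n) :
      ‖rightInner D (u i : Y) (op d • (v i : Y))‖ ≤ ‖(u i : Y)‖ * ‖(v i : Y)‖ * M :=
    calc ‖rightInner D (u i : Y) (op d • (v i : Y))‖
        ≤ ‖(u i : Y)‖ * ‖op d • (v i : Y)‖ := by
          rw [rightInner, norm_unop]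
          exact CStarModule.norm_inner_le Y
      _ ≤ ‖(u i : Y)‖ * (M * ‖(v i : Y)‖) := by gcongr; exact hd _ (v i).2
      _ = ‖(u i : Y)‖ * ‖(v i : Y)‖ * M := by ring
  calc ‖d‖ ≤ ∑ i, ‖(u i : Y)‖ * ‖(v i : Y)‖ * M := by
        conv_lhs => rw [hexpand]
        exact norm_sum_le_of_le _ fun i _ => hterm i
    _ ≤ (∑ i, ‖(u i : Y)‖ * ‖(v i : Y)‖ + 1) * M := by
        rw [← Finset.sum_mul]
        gcongr
        exact le_add_of_nonneg_right zero_le_one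

variable [StarOrderedRing C] [StarOrderedRing D]

theorem IsMoritaEquivalence.norm_op_sqrt_smul_rpow_smul_le (h : IsMoritaEquivalence A B X)
    {d b : D} (hd : 0 ≤ d) (hbB : b ∈ B) (hb : IsStrictlyPositive b) {K : ℝ}
    (hdb : ∀ x ∈ X, K ^ 2 • leftInner C (op d • x) x ≤ leftInner C (op b • x) x)
    {x : Y} (hx : x ∈ X) :
    K * ‖op (CFC.sqrt d) • op (b ^ (-(1 / 2) : ℝ)) • x‖ ≤ ‖x‖ := by
  have := h.bimodule
  set r := b ^ (-(1 / 2) : ℝ)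
  have hr : IsSelfAdjoint r := CFC.rpow_nonneg.isSelfAdjoint
  have hrx : op r • x ∈ X :=
    h.op_smul_mem r (rpow_mem_of_isClosed h.isClosed_right hbB hb.nonneg _) x hx
  have hle : K ^ 2 • leftInner C (op d • op r • x) (op r • x) ≤ leftInner C x x :=
    calc K ^ 2 • leftInner C (op d • op r • x) (op r • x)
        ≤ leftInner C (op b • op r • x) (op r • x) := hdb _ hrx
      _ = leftInner C (op (r * b * r) • x) x := (leftInner_op_conjugate_smul hr b x).symm
      _ = leftInner C x x := by rw [CFC.conjugate_rpow_neg_one_half b hb, op_one, one_smul]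
  have hnonneg : 0 ≤ K ^ 2 • leftInner C (op d • op r • x) (op r • x) :=
    smul_nonneg (sq_nonneg K) (leftInner_op_smul_self_nonneg hd _)
  refine le_of_sq_le_sq ?_ (norm_nonneg x)
  calc (K * ‖op (CFC.sqrt d) • op r • x‖) ^ 2
      = ‖K ^ 2 • leftInner C (op d • op r • x) (op r • x)‖ := by
        rw [mul_pow, norm_op_sqrt_smul_sq (C := C) hd, norm_smul,
          Real.norm_of_nonneg (sq_nonneg K)]
    _ ≤ ‖leftInner C x x‖ := CStarAlgebra.norm_le_norm_of_nonneg_of_le hnonneg hle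
    _ = ‖x‖ ^ 2 := (CStarModule.norm_sq_eq C).symm

theorem IsMoritaEquivalence.exists_le_of_smul_leftInner_le (h : IsMoritaEquivalence A B X) :
    ∃ K : ℝ, 0 < K ∧ ∀ d b : D, 0 ≤ d → 0 ≤ b → b ∈ B →
      (∀ x ∈ X, K • leftInner C (op d • x) x ≤ leftInner C (op b • x) x) → d ≤ b := by
  have := h.bimodule
  obtain ⟨K, hK, hnorm⟩ := h.exists_norm_le
  refine ⟨K ^ 2, by positivity, fun d b hd hb hbB hdb => ?_⟩
  refine le_of_forall_le_add_algebraMap fun ε hε => ?_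
  have hεpos : IsStrictlyPositive (algebraMap ℝ D ε) := isStrictlyPositive_algebraMap hε
  have hbε : IsStrictlyPositive (b + algebraMap ℝ D ε) := hεpos.nonneg_add hb
  have hbεB : b + algebraMap ℝ D ε ∈ B := add_mem hbB <| by
    rw [IsScalarTower.algebraMap_apply ℝ ℂ D]
    exact algebraMap_mem B _
  have hdbε (x : Y) (hx : x ∈ X) :
      K ^ 2 • leftInner C (op d • x) x ≤ leftInner C (op (b + algebraMap ℝ D ε) • x) x := by
    refine (hdb x hx).trans (sub_nonneg.1 ?_)
    rw [← leftInner_op_sub_smul, add_sub_cancel_left]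
    exact leftInner_op_smul_self_nonneg hεpos.nonneg x
  set r := (b + algebraMap ℝ D ε) ^ (-(1 / 2) : ℝ)
  have hr : IsSelfAdjoint r := CFC.rpow_nonneg.isSelfAdjoint
  have hnorm_le : ‖r * CFC.sqrt d‖ ≤ K * K⁻¹ := by
    refine hnorm _ _ (by positivity) fun x hx => ?_
    rw [op_mul, mul_smul, le_inv_mul_iff₀ hK]
    exact h.norm_op_sqrt_smul_rpow_smul_le hd hbεB hbε hdbε hx
  rwa [mul_inv_cancel₀ hK.ne', ← norm_star, star_mul, hr.star_eq,
    (CFC.sqrt_nonneg d).isSelfAdjoint.star_eq, ← le_iff_norm_sqrt_mul_rpow d _ hd hbε] at hnorm_le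

theorem IsMoritaEquivalence.nonneg_of_isSelfAdjoint (h : IsMoritaEquivalence A B X) {b : D}
    (hbB : b ∈ B) (hb : IsSelfAdjoint b) (hbX : ∀ x ∈ X, 0 ≤ leftInner C (op b • x) x) :
    0 ≤ b := by
  have := h.bimodule
  obtain ⟨K, hK, hcomp⟩ := h.exists_le_of_smul_leftInner_le
  rw [← CFC.negPart_eq_zero_iff b hb]
  have hk : 0 ≤ b⁻ := CFC.negPart_nonneg b
  have hkB : b⁻ ∈ B := cfcₙ_mem (𝕜' := ℂ) (hs := h.isClosed_right) _ hbB
  set k := b⁻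
  -- The form of `k³ = -kbk` is nonpositive on `X`, so `k³` compares with `0`.
  have hkbk : k * k * k = -(k * b * k) := by
    conv_rhs => rw [← CFC.posPart_sub_negPart b hb]
    rw [mul_sub, CFC.negPart_mul_posPart, zero_sub, neg_mul, neg_neg]
  have hcube : 0 ≤ k * k * k := hk.isSelfAdjoint.conjugate_nonneg hk
  have hcube_le : k * k * k ≤ 0 := by
    refine hcomp _ 0 hcube le_rfl (zero_mem B) fun x hx => ?_
    have hbkx := hbX _ (h.op_smul_mem k hkB x hx)
    rw [hkbk, leftInner_op_neg_smul, leftInner_op_conjugate_smul hk.isSelfAdjoint, smul_neg]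
    simpa [leftInner] using smul_nonneg hK.le hbkx
  have hsq : k * k = 0 := by
    rw [← CStarRing.star_mul_self_eq_zero_iff, star_mul, hk.isSelfAdjoint.star_eq, ← mul_assoc,
      le_antisymm hcube_le hcube, zero_mul]
  rwa [← CStarRing.star_mul_self_eq_zero_iff, hk.isSelfAdjoint.star_eq]

theorem IsMoritaEquivalence.isSelfAdjoint_of_leftInner [IsScalarTower ℂ Dᵐᵒᵖ Y]
    (h : IsMoritaEquivalence A B X) {b : D} (hbB : b ∈ B)
    (hbX : ∀ x ∈ X, IsSelfAdjoint (leftInner C (op b • x) x)) : IsSelfAdjoint b := by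
  have := h.bimodule
  have hskewB : star b - b ∈ B := sub_mem (star_mem hbB) hbB
  -- The form of this multiple of the imaginary part of `b` vanishes on `X`, so `0 ≤ w` and `w ≤ 0`.
  set w := Complex.I • (star b - b)
  have hwB : w ∈ B := B.smul_mem hskewB _
  have hw : IsSelfAdjoint w := by simp [w, IsSelfAdjoint, ← smul_neg]
  have hwX (x : Y) (hx : x ∈ X) : leftInner C (op w • x) x = 0 := by
    rw [leftInner_op_smul_smul, leftInner_op_sub_smul, leftInner_op_star_smul,
      (hbX x hx).star_eq, sub_self, smul_zero]
  have hw_nonneg : 0 ≤ w := h.nonneg_of_isSelfAdjoint hwB hw fun x hx => (hwX x hx).ge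
  have hw_nonpos : 0 ≤ -w := h.nonneg_of_isSelfAdjoint (neg_mem hwB) hw.neg fun x hx => by
    rw [leftInner_op_neg_smul, hwX x hx, neg_zero]
  have hw_zero : w = 0 := le_antisymm (neg_nonneg.1 hw_nonpos) hw_nonneg
  exact sub_eq_zero.1 ((smul_eq_zero.1 hw_zero).resolve_left Complex.I_ne_zero)

theorem IsMoritaEquivalence.nonneg_of_leftInner_nonneg [IsScalarTower ℂ Dᵐᵒᵖ Y]
    (h : IsMoritaEquivalence A B X) {b : D} (hbB : b ∈ B)
    (hbX : ∀ x ∈ X, 0 ≤ leftInner C (op b • x) x) : 0 ≤ b :=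
  h.nonneg_of_isSelfAdjoint hbB
    (h.isSelfAdjoint_of_leftInner hbB fun x hx => (hbX x hx).isSelfAdjoint) hbX

end MoritaEquivalence

section Transfer

variable {C D Y : Type*} [CStarAlgebra C] [PartialOrder C] [CStarAlgebra D] [PartialOrder D]
  [NormedAddCommGroup Y] [NormedSpace ℂ Y] [Module C Y] [Module Dᵐᵒᵖ Y]
  [CStarModule C Y] [CStarModule Dᵐᵒᵖ Y]
  {A : StarSubalgebra ℂ C} {B : StarSubalgebra ℂ D} {X : Submodule ℂ Y} {φ : bimoduleMaps A}

theorem IsTransfer.leftInner_op_smul {τ : Y →ₗ[ℂ] X} {ψ : bimoduleMaps B}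
    (hT : IsTransfer φ τ ψ) (d : D) {x z : Y} (hx : x ∈ X) (hz : z ∈ X) :
    leftInner C (op (ψ.1 d : D) • x) z = φ.1 (leftInner C (op d • x) z) := by
  rw [← hT.map_op_smul_coe ⟨x, hx⟩, hT.leftInner_map _ ⟨z, hz⟩]

variable [StarOrderedRing C] [StarOrderedRing D]
  [IsScalarTower ℂ C Y] [IsScalarTower ℂ Dᵐᵒᵖ Y] [SMulCommClass C Dᵐᵒᵖ Y]

theorem IsMoritaEquivalence.leftInner_op_transfer_smul (h : IsMoritaEquivalence A B X)
    (φ : bimoduleMaps A) (d : D) {x z : Y} (hx : x ∈ X) (hz : z ∈ X) :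
    leftInner C (op ((h.transfer φ).1 d : D) • x) z = φ.1 (leftInner C (op d • x) z) :=
  (h.existsUnique_transfer φ).choose_spec.1.leftInner_op_smul d hx hz

end Transfer

end CStarInclusion

open CStarInclusion in
theorem proposition3p6_general {C D Y : Type*}
    [CStarAlgebra C] [PartialOrder C] [StarOrderedRing C]
    [CStarAlgebra D] [PartialOrder D] [StarOrderedRing D]
    [NormedAddCommGroup Y] [NormedSpace ℂ Y] [Module C Y] [Module Dᵐᵒᵖ Y]
    [IsScalarTower ℂ C Y] [IsScalarTower ℂ Dᵐᵒᵖ Y] [SMulCommClass C Dᵐᵒᵖ Y]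
    [CStarModule C Y] [CStarModule Dᵐᵒᵖ Y]
    (A : StarSubalgebra ℂ C) (B : StarSubalgebra ℂ D) (X : Submodule ℂ Y)
    (h : IsMoritaEquivalence A B X) (φ : bimoduleMaps A)
    (ht : ∃ t : ℝ, 0 < t ∧ ∀ c : C, 0 ≤ c → t • c ≤ (φ.1 c : C)) :
    ∃ s : ℝ, 0 < s ∧ ∀ d : D, 0 ≤ d → s • d ≤ ((h.transfer φ).1 d : D) := by
  have := h.bimodule
  obtain ⟨t, ht, htφ⟩ := ht
  obtain ⟨K, hK, hcomp⟩ := h.exists_le_of_smul_leftInner_le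
  refine ⟨t / K, by positivity, fun d hd => ?_⟩
  have hψX (x : Y) (hx : x ∈ X) :
      t • leftInner C (op d • x) x ≤ leftInner C (op ((h.transfer φ).1 d : D) • x) x := by
    rw [h.leftInner_op_transfer_smul φ d hx hx]
    exact htφ _ (leftInner_op_smul_self_nonneg hd x)
  have hψ : 0 ≤ ((h.transfer φ).1 d : D) :=
    h.nonneg_of_leftInner_nonneg ((h.transfer φ).1 d).2 fun x hx =>
      (smul_nonneg ht.le (leftInner_op_smul_self_nonneg hd x)).trans (hψX x hx)
  refine hcomp _ _ (by positivity) hψ ((h.transfer φ).1 d).2 fun x hx => ?_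
  calc K • leftInner C (op ((t / K) • d) • x) x = t • leftInner C (op d • x) x := by
        rw [← Complex.coe_smul (t / K) d, leftInner_op_smul_smul, Complex.coe_smul, smul_smul,
          mul_div_cancel₀ t hK.ne']
    _ ≤ leftInner C (op ((h.transfer φ).1 d : D) • x) x := hψX x hx

theorem proposition3p6 {C D Y : Type*}
    [CStarAlgebra C] [PartialOrder C] [StarOrderedRing C]
    [CStarAlgebra D] [PartialOrder D] [StarOrderedRing D]
    [NormedAddCommGroup Y] [NormedSpace ℂ Y] [Module C Y] [Module Dᵐᵒᵖ Y]
    [IsScalarTower ℂ C Y] [IsScalarTower ℂ Dᵐᵒᵖ Y] [SMulCommClass C Dᵐᵒᵖ Y]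
    [CStarModule C Y] [CStarModule Dᵐᵒᵖ Y]
    (A : StarSubalgebra ℂ C) (B : StarSubalgebra ℂ D) (X : Submodule ℂ Y)
    (h : CStarInclusion.IsMoritaEquivalence A B X)
    (φ : CStarInclusion.bimoduleMaps A) (hφ : CStarInclusion.IsConditionalExpectation φ)
    (ht : ∃ t : ℝ, 0 < t ∧ ∀ c : C, 0 ≤ c → t • c ≤ (φ.1 c : C)) :
    ∃ s : ℝ, 0 < s ∧ ∀ d : D, 0 ≤ d → s • d ≤ ((h.transfer φ).1 d : D) := by
  exact proposition3p6_general A B X h φ ht
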